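/- An effective approximation of a real $x$ is a sequence $(q_n)_{n\in\mathbb N}$ of rationals with $|q_n-q_{n+1}|<2^{-n}$ for all $n$ and $\lim_n q_n=x$. A real function $f$ is computable on a set $X\subseteq\mathrm{dom}(f)$ if there is a single oracle Turing machine that, for every $x\in X$ and every effective approximation of $x$ given as an oracle (rationals being finitely encoded), outputs an effective approximation of $f(x)$. For reals $\alpha$ and $\beta>0$, write $\alpha\le_{\mathrm{cl}}^{\mathrm{open}}\beta$ if there is a real function $f$ that is computable and Lipschitz continuous on $[0,\beta)$ and satisfies $\lim_{x\nearrow\beta}f(x)=\alpha$. For reals $\alpha$ and $\beta\ge 0$, write $\alpha\le_{\mathrm{cl}}^{\mathrm{loc}}\beta$ if there are a real $b>\beta$ and a real function $f$ that is computable and Lipschitz continuous on $[0,b]$ and satisfies $f(\beta)=\alpha$. A Martin-Löf test is a sequence $(U_n)_{n\in\mathbb N}$ of uniformly c.e. open subsets of $\mathbb R$ (that is, $U_n=\bigcup_k (l_{n,k},r_{n,k})$ with rational endpoints computable from $n,k$) with Lebesgue measure $\mu(U_n)\le 2^{-n}$ for all $n$; it is a Schnorr test if, in addition, the reals $\mu(U_n)$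 are computable uniformly in $n$. A real $x$ is Martin-Löf random (Schnorr random) if $x\notin\bigcap_n U_n$ for every Martin-Löf test (Schnorr test) $(U_n)$. Proposition. The set of Martin-Löf random reals is $\le_{\mathrm{cl}}^{\mathrm{open}}$-closed upwards, and the set of Schnorr random reals is $\le_{\mathrm{cl}}^{\mathrm{loc}}$-closed upwards. That is: (a) For all reals $\alpha$ and $\beta>0$: if $\alpha\le_{\mathrm{cl}}^{\mathrm{open}}\beta$ and $\beta$ is not Martin-Löf random, then $\alpha$ is not Martin-Löf random. (b) For all reals $\alpha$ and $\beta\ge 0$: if $\alpha\le_{\mathrm{cl}}^{\mathrm{loc}}\beta$ and $\beta$ is not Schnorr random, then $\alpha$ is not Schnorr random. -/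

import Mathlib

open Filter Topology MeasureTheory
open scoped NNReal ENNReal

namespace SolovayVariants

/-! ### Finite encoding of rationals -/

/-- The standard numbering of the rationals: the natural number coding the triple `(a, b, c)`
is a code of the rational `(a - b) / (c + 1)`. Every rational has a code. -/
def ratOfCode (n : ℕ) : ℚ :=
  ((n.unpair.1 : ℚ) - (n.unpair.2.unpair.1 : ℚ)) / ((n.unpair.2.unpair.2 : ℚ) + 1)

theorem ratOfCode_surjective : Function.Surjective ratOfCode := by
  intro q
  refine ⟨Nat.pair q.num.toNat (Nat.pair (-q.num).toNat (q.den - 1)), ?_⟩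
  have h1 : ((q.num.toNat : ℤ) : ℚ) - (((-q.num).toNat : ℤ) : ℚ) = (q.num : ℚ) := by
    rw [← Int.cast_sub, Int.toNat_sub_toNat_neg]
  have h2 : ((q.den - 1 : ℕ) : ℚ) + 1 = q.den := by
    have := q.pos
    rw [← Nat.cast_succ, Nat.succ_eq_add_one, Nat.sub_add_cancel this]
  simp only [ratOfCode, Nat.unpair_pair]
  rw [h2]
  simp only [Int.cast_natCast] at h1
  rw [h1, Rat.num_div_den]

/-! ### Oracle machines -/

/-- Programs of oracle machines on the natural numbers, in the form of descriptions of partial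
recursive functionals. (One program is run on many oracles, so the program is a datum
that does not depend on the oracle.) -/
inductive OracleCode : Type
  | zero : OracleCode
  | succ : OracleCode
  | left : OracleCode
  | right : OracleCode
  | oracle : OracleCode
  | pair : OracleCode → OracleCode → OracleCode
  | comp : OracleCode → OracleCode → OracleCode
  | prec : OracleCode → OracleCode → OracleCode
  | rfind : OracleCode → OracleCode

/-- The partial function computed by an oracle program with the oracle `O`. The clauses are the
ones of `Nat.RecursiveIn {O}`. -/
def OracleCode.eval (O : ℕ → ℕ) : OracleCode → ℕ →. ℕ
  | .zero => fun _ => Part.some 0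
  | .succ => fun n => Part.some (n + 1)
  | .left => fun n => Part.some n.unpair.1
  | .right => fun n => Part.some n.unpair.2
  | .oracle => fun n => Part.some (O n)
  | .pair c d => fun n => Nat.pair <$> c.eval O n <*> d.eval O n
  | .comp c d => fun n => d.eval O n >>= c.eval O
  | .prec c d => fun p =>
      p.unpair.2.rec (c.eval O p.unpair.1) fun y IH =>
        IH >>= fun i => d.eval O (Nat.pair p.unpair.1 (Nat.pair y i))
  | .rfind c => fun a =>
      Nat.rfind fun n => (fun m => decide (m = 0)) <$> c.eval O (Nat.pair a n)

/-- The machine `M`, given the sequence of rationals coded by `p` as an oracle, returns the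
infinite sequence of rationals coded by `q`. -/
def OracleCode.Returns (M : OracleCode) (p q : ℕ → ℕ) : Prop :=
  ∀ n, q n ∈ M.eval p n

/-! ### Computable real functions -/

/-- `q₀, q₁, …` is an effective approximation of the real `x`. -/
def IsEffectiveApprox (q : ℕ → ℚ) (x : ℝ) : Prop :=
  (∀ n, |q n - q (n + 1)| < (2⁻¹ : ℚ) ^ n) ∧ Tendsto (fun n => (q n : ℝ)) atTop (𝓝 x)

/-- The real function `f` is (Type 2) computable on the set `X`: one oracle machine turns every
effective approximation of every `x ∈ X` into an effective approximation of `f x`. -/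
def ComputableRealOn (f : ℝ → ℝ) (X : Set ℝ) : Prop :=
  ∃ M : OracleCode, ∀ x ∈ X, ∀ p : ℕ → ℕ, IsEffectiveApprox (fun n => ratOfCode (p n)) x →
    ∃ q : ℕ → ℕ, M.Returns p q ∧ IsEffectiveApprox (fun n => ratOfCode (q n)) (f x)

/-! ### The two reducibilities

Only the values of `f` on the stated interval matter, so a partial real function defined there is
represented by an arbitrary extension of it to `ℝ`. -/

/-- `f` is a weakly `ℝ`-translation function from `β` to `α` (for `0 < β`). -/
def IsWeakTranslation (f : ℝ → ℝ) (β α : ℝ) : Prop :=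
  ComputableRealOn f (Set.Ico 0 β) ∧ Tendsto f (𝓝[<] β) (𝓝 α)

/-- `α` is computably Lipschitz reducible to `β` on a c.e. open interval. -/
def ClOpenReducible (α β : ℝ) : Prop :=
  ∃ f : ℝ → ℝ, IsWeakTranslation f β α ∧ ∃ K : ℝ≥0, LipschitzOnWith K f (Set.Ico 0 β)

/-- `α` is computably Lipschitz reducible to `β` locally. -/
def ClLocReducible (α β : ℝ) : Prop :=
  ∃ b : ℝ, β < b ∧ ∃ f : ℝ → ℝ, ComputableRealOn f (Set.Icc 0 b) ∧
    (∃ K : ℝ≥0, LipschitzOnWith K f (Set.Icc 0 b)) ∧ f β = α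

/-! ### Martin-Löf and Schnorr randomness -/

/-- `U₀, U₁, …` are uniformly effectively (c.e.) open sets of reals: `Uₙ` is the union of
rational open intervals enumerated computably, uniformly in `n`. (An interval whose left endpoint
is not below its right endpoint is empty.) -/
def UniformlyCEOpen (U : ℕ → Set ℝ) : Prop :=
  ∃ l r : ℕ → ℕ → ℕ, Computable₂ l ∧ Computable₂ r ∧
    ∀ n, U n = ⋃ k, Set.Ioo (ratOfCode (l n k) : ℝ) (ratOfCode (r n k) : ℝ)

/-- Martin-Löf tests. -/
def IsMartinLofTest (U : ℕ → Set ℝ) : Prop :=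
  UniformlyCEOpen U ∧ ∀ n, volume (U n) ≤ (2⁻¹ : ℝ≥0∞) ^ n

/-- The reals `x₀, x₁, …` are uniformly computable. -/
def UniformlyComputable (x : ℕ → ℝ) : Prop :=
  ∃ a : ℕ → ℕ → ℕ, Computable₂ a ∧
    ∀ n i, |x n - (ratOfCode (a n i) : ℝ)| ≤ (2⁻¹ : ℝ) ^ i

/-- Schnorr tests: Martin-Löf tests whose measures are uniformly computable. -/
def IsSchnorrTest (U : ℕ → Set ℝ) : Prop :=
  IsMartinLofTest U ∧ UniformlyComputable fun n => (volume (U n)).toReal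

/-- A real is Martin-Löf random if it passes every Martin-Löf test. -/
def MartinLofRandom (x : ℝ) : Prop :=
  ∀ U : ℕ → Set ℝ, IsMartinLofTest U → x ∉ ⋂ n, U n

/-- A real is Schnorr random if it passes every Schnorr test. -/
def SchnorrRandom (x : ℝ) : Prop :=
  ∀ U : ℕ → Set ℝ, IsSchnorrTest U → x ∉ ⋂ n, U n

end SolovayVariants

/-! A Lipschitz map stretches lengths by at most a constant factor, so it carries a test capturing
`β` to one capturing `α`, provided the images can be enumerated with controlled measure. Enumerated
intervals may overlap and have infinite total length, so each `U n` is first cut into disjoint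
dyadic cells whose lengths sum to its measure (`Accepted.unique`, `exists_accepted`,
`tsum_acceptedLength`). A cell of length `1 / 2 ^ s` is replaced by a rational interval of radius `C
/ 2 ^ s`, `C = K + 3`, around an approximation of `f` at its left endpoint. That endpoint is dyadic,
so the machine can run on a constant oracle. The measure grows at most by the factor `2 * C`, which
an index shift absorbs.

For Martin-Löf tests, `f` is available only on `[0, β)`. Cells are open on the left, so the cell
containing `β` starts before `β` and its image is found. Elsewhere the machine may diverge, which
only omits an interval, or return anything, which leaves the length bound intact.

For Schnorr tests the new measures must be computable. A rational between `β` and `b` decides where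
to run the machine, so every cell gets its value computably (`exists_computable_cell_approx`).
Computability of `volume (U n)` tells when finitely many cells exhaust it up to a small error; the
remaining images are then small as well, and a finite union is measured by counting grid cells. -/

namespace SolovayVariants

/-! ### Closure properties of computable functions and predicates -/

section Computability

variable {α : Type*} {σ : Type*} [Primcodable α] [Primcodable σ]

theorem computable_add {f g : α → ℕ} (hf : Computable f) (hg : Computable g) :
    Computable fun a => f a + g a :=
  Primrec.nat_add.to_comp.comp hf hg

theorem computable_sub {f g : α → ℕ} (hf : Computable f) (hg : Computable g) :
    Computable fun a => f a - g a :=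
  Primrec.nat_sub.to_comp.comp hf hg

theorem computable_mul {f g : α → ℕ} (hf : Computable f) (hg : Computable g) :
    Computable fun a => f a * g a :=
  Primrec.nat_mul.to_comp.comp hf hg

theorem computable_div {f g : α → ℕ} (hf : Computable f) (hg : Computable g) :
    Computable fun a => f a / g a :=
  Primrec.nat_div.to_comp.comp hf hg

theorem computable_pair {f g : α → ℕ} (hf : Computable f) (hg : Computable g) :
    Computable fun a => Nat.pair (f a) (g a) :=
  Primrec₂.natPair.to_comp.comp hf hg

theorem computable_unpair_fst {f : α → ℕ} (hf : Computable f) :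
    Computable fun a => (f a).unpair.1 :=
  Computable.fst.comp (Computable.unpair.comp hf)

theorem computable_unpair_snd {f : α → ℕ} (hf : Computable f) :
    Computable fun a => (f a).unpair.2 :=
  Computable.snd.comp (Computable.unpair.comp hf)

theorem computable_two_pow {f : α → ℕ} (hf : Computable f) : Computable fun a => 2 ^ f a := by
  have h : Primrec₂ ((· ^ ·) : ℕ → ℕ → ℕ) := Primrec₂.unpaired'.1 Nat.Primrec.pow
  exact h.to_comp.comp (Computable.const 2) hf

theorem computablePred_le {f g : α → ℕ} (hf : Computable f) (hg : Computable g) :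
    ComputablePred fun a => f a ≤ g a :=
  Computable.computablePred ((Primrec.nat_le.decide).to_comp.comp hf hg)

theorem computablePred_and {p q : α → Prop} (hp : ComputablePred p) (hq : ComputablePred q) :
    ComputablePred fun a => p a ∧ q a := by
  classical
  exact Computable.computablePred
    ((Primrec.and.to_comp.comp hp.decide hq.decide).of_eq fun a => by simp)

theorem computable_ite {p : α → Prop} [DecidablePred p] {f g : α → σ} (hp : ComputablePred p)
    (hf : Computable f) (hg : Computable g) : Computable fun a => if p a then f a else g a :=
  (Computable.cond hp.decide hf hg).of_eq fun a => by by_cases h : p a <;> simp [h]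

theorem computable_sum_range {f : α → ℕ} {g : α → ℕ → ℕ} (hf : Computable f)
    (hg : Computable₂ g) : Computable fun a => ∑ k ∈ Finset.range (f a), g a k := by
  have h : Computable₂ fun (a : α) (p : ℕ × ℕ) => p.2 + g a p.1 :=
    computable_add (Computable.snd.comp Computable.snd)
      (hg.comp Computable.fst (Computable.fst.comp Computable.snd))
  refine (Computable.nat_rec hf (Computable.const 0) h).of_eq fun a => ?_
  induction f a with
  | zero => rfl
  | succ k ih => rw [Finset.sum_range_succ, ← ih]

theorem computablePred_exists_lt {f : α → ℕ} {p : α → ℕ → Prop} (hf : Computable f)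
    (hp : ComputablePred fun x : α × ℕ => p x.1 x.2) :
    ComputablePred fun a => ∃ k < f a, p a k := by
  classical
  have hs : Computable fun a => ∑ k ∈ Finset.range (f a), if p a k then 1 else 0 :=
    computable_sum_range hf (computable_ite hp (Computable.const 1) (Computable.const 0))
  refine (computablePred_le (Computable.const 1) hs).of_eq fun a => ?_
  rw [Nat.one_le_iff_ne_zero, Ne, Finset.sum_eq_zero_iff]
  simp

/-- A partial computable function has a computable enumeration of its graph. -/
theorem exists_computable_stages {g : ℕ →. ℕ} (hg : Partrec g) :
    ∃ h : ℕ → ℕ → Option ℕ, Computable₂ h ∧ ∀ n x, x ∈ g n ↔ ∃ t, h n t = some x := by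
  obtain ⟨c, rfl⟩ := Nat.Partrec.Code.exists_code.1 (Partrec.nat_iff.1 hg)
  refine ⟨fun n t => c.evaln t n, ?_, fun n x => ?_⟩
  · exact Nat.Partrec.Code.primrec_evaln.to_comp.comp
      (((Computable.snd.pair (Computable.const c))).pair Computable.fst)
  · simp [Nat.Partrec.Code.evaln_complete]

end Computability

/-! ### Rational codes -/

theorem ratOfCode_le_iff (m n : ℕ) : ratOfCode m ≤ ratOfCode n ↔
    m.unpair.1 * (n.unpair.2.unpair.2 + 1) + n.unpair.2.unpair.1 * (m.unpair.2.unpair.2 + 1) ≤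
    n.unpair.1 * (m.unpair.2.unpair.2 + 1) + m.unpair.2.unpair.1 * (n.unpair.2.unpair.2 + 1) := by
  unfold ratOfCode
  rw [div_le_div_iff₀ (by positivity) (by positivity)]
  rw [← Nat.cast_le (α := ℚ)]
  push_cast
  constructor <;> intro h <;> linarith

theorem computablePred_ratOfCode_le {α : Type*} [Primcodable α] {f g : α → ℕ}
    (hf : Computable f) (hg : Computable g) :
    ComputablePred fun a => (ratOfCode (f a) : ℝ) ≤ ratOfCode (g a) := by
  have d : ∀ {f : α → ℕ}, Computable f → Computable fun a => (f a).unpair.2.unpair.2 + 1 :=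
    fun hf => computable_add (computable_unpair_snd (computable_unpair_snd hf))
      (Computable.const 1)
  have b : ∀ {f : α → ℕ}, Computable f → Computable fun a => (f a).unpair.2.unpair.1 :=
    fun hf => computable_unpair_fst (computable_unpair_snd hf)
  refine (computablePred_le
    (computable_add (computable_mul (computable_unpair_fst hf) (d hg))
      (computable_mul (b hg) (d hf)))
    (computable_add (computable_mul (computable_unpair_fst hg) (d hf))
      (computable_mul (b hf) (d hg)))).of_eq fun a => ?_
  rw [Rat.cast_le, ratOfCode_le_iff]

/-- A code of the dyadic rational `(a - b) / 2 ^ s`. -/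
def dyadicCode (a b s : ℕ) : ℕ := Nat.pair a (Nat.pair b (2 ^ s - 1))

theorem ratOfCode_dyadicCode (a b s : ℕ) :
    (ratOfCode (dyadicCode a b s) : ℝ) = ((a : ℝ) - b) / 2 ^ s := by
  simp [ratOfCode, dyadicCode]

theorem computable_dyadicCode {α : Type*} [Primcodable α] {f g h : α → ℕ} (hf : Computable f)
    (hg : Computable g) (hh : Computable h) : Computable fun a => dyadicCode (f a) (g a) (h a) :=
  computable_pair hf (computable_pair hg (computable_sub (computable_two_pow hh)
    (Computable.const 1)))

/-! ### Machines with a constant oracle -/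

/-- With a constant oracle, the oracle's value becomes one more numerical input of an ordinary
partial recursive function. This suffices because a rational point is effectively approximated by
its constant sequence. -/
theorem partrec_eval_const (M : OracleCode) :
    Partrec fun x : ℕ × ℕ => M.eval (fun _ => x.1) x.2 := by
  induction M with
  | zero => exact (Computable.const 0).partrec
  | succ => exact (Computable.succ.comp Computable.snd).partrec
  | left => exact (computable_unpair_fst Computable.snd).partrec
  | right => exact (computable_unpair_snd Computable.snd).partrec
  | oracle => exact Computable.fst.partrec
  | pair c d hc hd =>
    refine (hc.bind ((hd.comp Computable.fst).map (computable_pair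
      (Computable.snd.comp Computable.fst) Computable.snd).to₂).to₂).of_eq fun x => ?_
    simp [OracleCode.eval, Seq.seq]
  | comp c d hc hd =>
    exact hd.bind (hc.comp ((Computable.fst.comp Computable.fst).pair Computable.snd)).to₂
  | prec c d hc hd =>
    refine (Partrec.nat_rec (computable_unpair_snd Computable.snd)
      (hc.comp (Computable.fst.pair (computable_unpair_fst Computable.snd)))
      (h := fun x p => d.eval (fun _ => x.1) (Nat.pair x.2.unpair.1 (Nat.pair p.1 p.2)))
      (hd.comp ((Computable.fst.comp Computable.fst).pair (computable_pair
        (computable_unpair_fst (Computable.snd.comp Computable.fst))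
        (computable_pair (Computable.fst.comp Computable.snd)
          (Computable.snd.comp Computable.snd))))).to₂).of_eq fun x => rfl
  | rfind c hc =>
    have h0 : Computable fun m : ℕ => decide (m = 0) :=
      ((Primrec.eq (α := ℕ)).decide.comp Primrec.id (Primrec.const 0)).to_comp
    refine Partrec.rfind (p := fun (x : ℕ × ℕ) n =>
      (c.eval (fun _ => x.1) (Nat.pair x.2 n)).map fun m => decide (m = 0)) ?_
    exact (hc.comp ((Computable.fst.comp Computable.fst).pair (computable_pair
      (Computable.snd.comp Computable.fst) Computable.snd))).map (h0.comp Computable.snd).to₂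

/-! ### Approximating a computable real function at dyadic points -/

theorem IsEffectiveApprox.abs_sub_le {q : ℕ → ℚ} {x : ℝ} (h : IsEffectiveApprox q x) (n : ℕ) :
    |(q n : ℝ) - x| ≤ 2 / 2 ^ n := by
  have := dist_le_of_le_geometric_of_tendsto (f := fun n => (q n : ℝ)) (1 / 2) 1 (by norm_num)
    (fun n => ?_) h.2 n
  · rw [Real.dist_eq] at this
    refine this.trans_eq ?_
    rw [one_div, inv_pow]
    field_simp
    norm_num
  · rw [Real.dist_eq]
    have := (h.1 n).le
    rw [← Rat.cast_le (K := ℝ)] at this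
    push_cast at this
    simpa using this

theorem isEffectiveApprox_const (q : ℚ) : IsEffectiveApprox (fun _ => q) q :=
  ⟨fun n => by simp, tendsto_const_nhds⟩

/-- The shift by `B` makes the approximations nonnegative, so a natural numerator over `2 ^ s` can
encode them. Half of the error comes from the machine's term `s + 1`, half from rounding down. -/
theorem ComputableRealOn.exists_dyadic_approx {f : ℝ → ℝ} {X : Set ℝ}
    (hf : ComputableRealOn f X) (B : ℕ) (hB : ∀ x ∈ X, 1 - (B : ℝ) ≤ f x) :
    ∃ g : ℕ × ℕ →. ℕ, Partrec g ∧ ∀ m s : ℕ, (m / 2 ^ s : ℝ) ∈ X →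
      ∃ v ∈ g (m, s), |(v : ℝ) / 2 ^ s - B - f (m / 2 ^ s)| ≤ 2 / 2 ^ s := by
  obtain ⟨M, hM⟩ := hf
  refine ⟨fun x => (M.eval (fun _ => dyadicCode x.1 0 x.2) (x.2 + 1)).map fun c =>
    (c.unpair.1 + B * (c.unpair.2.unpair.2 + 1) - c.unpair.2.unpair.1) * 2 ^ x.2 /
      (c.unpair.2.unpair.2 + 1), ?_, fun m s hx => ?_⟩
  · have hd : Computable fun x : (ℕ × ℕ) × ℕ => x.2.unpair.2.unpair.2 + 1 :=
      computable_add (computable_unpair_snd (computable_unpair_snd Computable.snd))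
        (Computable.const 1)
    refine Partrec.map ((partrec_eval_const M).comp ((computable_dyadicCode Computable.fst
      (Computable.const 0) Computable.snd).pair
        (computable_add Computable.snd (Computable.const 1)))) ?_
    exact (computable_div (computable_mul (computable_sub (computable_add
      (computable_unpair_fst Computable.snd) (computable_mul (Computable.const B) hd))
        (computable_unpair_fst (computable_unpair_snd Computable.snd)))
      (computable_two_pow (Computable.snd.comp Computable.fst))) hd).to₂
  · have hc : (ratOfCode (dyadicCode m 0 s) : ℝ) = m / 2 ^ s := by
      rw [ratOfCode_dyadicCode]; simp
    have happ := isEffectiveApprox_const (ratOfCode (dyadicCode m 0 s))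
    rw [hc] at happ
    obtain ⟨q, hq, hqf⟩ := hM _ hx (fun _ => dyadicCode m 0 s) happ
    refine ⟨_, Part.mem_map _ (hq (s + 1)), ?_⟩
    have h1 := hqf.abs_sub_le (s + 1)
    set c := q (s + 1)
    have h2 := hB _ hx
    set y := f (m / 2 ^ s)
    have hpow : (1 : ℝ) ≤ 2 ^ s := one_le_pow₀ (by norm_num)
    have h1' : |(ratOfCode c : ℝ) - y| ≤ 1 / 2 ^ s := by
      refine h1.trans_eq ?_
      rw [pow_succ]; field_simp
    have hle : (1 : ℝ) / 2 ^ s ≤ 1 := by rw [div_le_one (by positivity)]; exact hpow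
    -- Hence the truncated subtraction in the numerator loses nothing.
    have h3 : 0 ≤ (ratOfCode c : ℝ) + B := by
      have := (abs_le.1 h1').1; linarith
    have hr : (ratOfCode c : ℝ) = ((c.unpair.1 : ℝ) - c.unpair.2.unpair.1) /
        ((c.unpair.2.unpair.2 + 1 : ℕ) : ℝ) := by
      simp [ratOfCode]
    have hd : 0 < c.unpair.2.unpair.2 + 1 := Nat.succ_pos _
    generalize c.unpair.2.unpair.2 + 1 = d at *
    generalize c.unpair.2.unpair.1 = b at *
    generalize c.unpair.1 = a at *
    have hd' : (0 : ℝ) < d := by exact_mod_cast hd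
    have hA : ((a + B * d - b : ℕ) : ℝ) = ((ratOfCode c : ℝ) + B) * d := by
      have he : ((ratOfCode c : ℝ) + B) * d = a + B * d - b := by
        rw [hr]; field_simp; ring
      have hb : b ≤ a + B * d := by
        rw [← Nat.cast_le (α := ℝ)]
        have := mul_nonneg h3 hd'.le
        push_cast; linarith
      rw [he, Nat.cast_sub hb]; push_cast; rfl
    generalize a + B * d - b = A at *
    have hv1 : ((A * 2 ^ s / d : ℕ) : ℝ) ≤ ((ratOfCode c : ℝ) + B) * 2 ^ s := by
      refine Nat.cast_div_le.trans_eq ?_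
      push_cast; rw [hA]; field_simp
    have hv2 : ((ratOfCode c : ℝ) + B) * 2 ^ s < ((A * 2 ^ s / d : ℕ) : ℝ) + 1 := by
      have := Nat.lt_mul_div_succ (A * 2 ^ s) hd
      rw [← Nat.cast_lt (α := ℝ)] at this
      push_cast at this
      rw [hA] at this
      exact lt_of_mul_lt_mul_left (by linarith) hd'.le
    generalize A * 2 ^ s / d = v at *
    have hp : (0 : ℝ) < 2 ^ s := by positivity
    rw [← div_le_iff₀ hp] at hv1
    rw [← lt_div_iff₀ hp, add_div] at hv2
    have h4 := abs_le.1 h1'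
    have h5 : (2 : ℝ) / 2 ^ s = 1 / 2 ^ s + 1 / 2 ^ s := by ring
    rw [h5, abs_le]
    constructor <;> linarith

/-! ### Dyadic decomposition of an open set

At level `s` the half-line `(-s, ∞)` is divided into the cells `(j / 2 ^ s - s, (j + 1) / 2 ^ s - s]`
with `j : ℕ`. -/

/-- The left endpoint of the cell with number `j` of level `s`. -/
noncomputable def cellLeft (s j : ℕ) : ℝ := (j : ℝ) / 2 ^ s - s

/-- The cell with number `j` of level `s`. -/
def cell (s j : ℕ) : Set ℝ := Set.Ioc (cellLeft s j) (cellLeft s j + 1 / 2 ^ s)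

/-- The cell with number `j` of level `s` lies in one of the first `s` intervals. -/
def Covered (l r : ℕ → ℝ) (s j : ℕ) : Prop :=
  ∃ k < s, l k ≤ cellLeft s j ∧ cellLeft s j + 1 / 2 ^ s ≤ r k

/-- The cell is covered and the cell of the previous level that contains it is not. -/
def Accepted (l r : ℕ → ℝ) (s j : ℕ) : Prop :=
  Covered l r s j ∧ ¬ (2 ^ s ≤ j ∧ Covered l r (s - 1) ((j - 2 ^ s) / 2))

theorem mem_cell_iff {s j : ℕ} {x : ℝ} :
    x ∈ cell s j ↔ (j : ℝ) < (x + s) * 2 ^ s ∧ (x + s) * 2 ^ s ≤ j + 1 := by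
  have h2 : (0 : ℝ) < 2 ^ s := by positivity
  rw [cell, cellLeft, Set.mem_Ioc, sub_lt_iff_lt_add, div_lt_iff₀ h2, ← le_div_iff₀ h2]
  refine and_congr_right fun _ => ?_
  rw [add_div]
  constructor <;> intro h <;> linarith

theorem exists_mem_cell {s : ℕ} {x : ℝ} (hx : -(s : ℝ) < x) : ∃ j, x ∈ cell s j := by
  have h : 0 < (x + s) * 2 ^ s := mul_pos (by linarith) (by positivity)
  have hc := Nat.ceil_pos.2 h
  refine ⟨⌈(x + s) * 2 ^ s⌉₊ - 1, mem_cell_iff.2 ⟨?_, ?_⟩⟩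
  · rw [← Nat.lt_ceil]; omega
  · have := Nat.le_ceil ((x + s) * 2 ^ s)
    rw [Nat.cast_sub hc]; push_cast; linarith

theorem neg_lt_of_mem_cell {s j : ℕ} {x : ℝ} (hx : x ∈ cell s j) : -(s : ℝ) < x := by
  have h := (Nat.cast_nonneg (α := ℝ) j).trans_lt (mem_cell_iff.1 hx).1
  have := pos_of_mul_pos_left h (by positivity)
  linarith

theorem cell_index_unique {s i j : ℕ} {x : ℝ} (hi : x ∈ cell s i) (hj : x ∈ cell s j) :
    i = j := by
  rw [mem_cell_iff] at hi hj
  have h1 : (i : ℝ) < j + 1 := by linarith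
  have h2 : (j : ℝ) < i + 1 := by linarith
  norm_cast at h1 h2
  omega

/-- Passing to level `s + 1` moves the origin one unit to the left, which is `2 ^ (s + 1)` new
cells; the halves of cell `i` come after these. -/
theorem mem_cell_parent {s i j : ℕ} {x : ℝ} (hi : x ∈ cell s i) (hj : x ∈ cell (s + 1) j) :
    2 ^ (s + 1) ≤ j ∧ (j - 2 ^ (s + 1)) / 2 = i := by
  rw [mem_cell_iff] at hi hj
  push_cast [pow_succ] at hi hj
  have h1 : ((2 * i + 2 * 2 ^ s : ℕ) : ℝ) < (j + 1 : ℕ) := by push_cast; nlinarith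
  have h2 : (j : ℝ) < ((2 * i + 2 * 2 ^ s + 2 : ℕ) : ℝ) := by push_cast; nlinarith
  rw [Nat.cast_lt] at h1 h2
  rw [pow_succ]
  omega

theorem cell_subset_parent {s i j : ℕ} (h : 2 * i + 2 ^ (s + 1) ≤ j)
    (h' : j ≤ 2 * i + 2 ^ (s + 1) + 1) :
    cellLeft s i ≤ cellLeft (s + 1) j ∧
      cellLeft (s + 1) j + 1 / 2 ^ (s + 1) ≤ cellLeft s i + 1 / 2 ^ s := by
  rw [← Nat.cast_le (α := ℝ)] at h h'
  push_cast [pow_succ] at h h'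
  have h2 : (0 : ℝ) < 2 ^ s := by positivity
  have e1 : cellLeft s i = (2 * i + 2 * 2 ^ s) / (2 ^ s * 2) - (s + 1) := by
    unfold cellLeft; field_simp; ring
  have e2 : (1 : ℝ) / 2 ^ s = 2 / (2 ^ s * 2) := by field_simp
  have e3 : cellLeft (s + 1) j = j / (2 ^ s * 2) - (s + 1) := by
    unfold cellLeft; push_cast [pow_succ]; ring
  rw [e1, e2, e3, pow_succ]
  constructor
  · gcongr; linarith
  · have : (j + 1 : ℝ) / (2 ^ s * 2) ≤ (2 * i + 2 * 2 ^ s + 2) / (2 ^ s * 2) :=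
      div_le_div_of_nonneg_right (by linarith) (by positivity)
    rw [add_div, add_div _ (2 : ℝ)] at this
    linarith

section Decomposition

variable {l r : ℕ → ℝ}

/-- Deeper levels have smaller cells and more intervals available, so coverage is inherited;
acceptance thus marks the first covered level. -/
theorem Covered.child {s i j : ℕ} {x : ℝ} (h : Covered l r s i) (hi : x ∈ cell s i)
    (hj : x ∈ cell (s + 1) j) : Covered l r (s + 1) j := by
  obtain ⟨k, hk, h1, h2⟩ := h
  have := mem_cell_parent hi hj
  obtain ⟨h3, h4⟩ := cell_subset_parent (s := s) (i := i) (j := j) (by omega) (by omega)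
  exact ⟨k, by omega, h1.trans h3, h4.trans h2⟩

theorem Covered.descendant {s t i j : ℕ} {x : ℝ} (hst : s ≤ t) (h : Covered l r s i)
    (hi : x ∈ cell s i) (hj : x ∈ cell t j) : Covered l r t j := by
  induction t, hst using Nat.le_induction generalizing j with
  | base => rwa [← cell_index_unique hi hj]
  | succ t hst ih =>
    have hx := neg_lt_of_mem_cell hi
    have : (s : ℝ) ≤ t := by exact_mod_cast hst
    obtain ⟨i', hi'⟩ := exists_mem_cell (s := t) (x := x) (by linarith)
    exact (ih hi').child hi' hj

theorem Accepted.not_covered {s t i j : ℕ} {x : ℝ} (h : Accepted l r t j) (hj : x ∈ cell t j)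
    (hst : s < t) (hi : x ∈ cell s i) : ¬ Covered l r s i := by
  intro hc
  obtain ⟨t, rfl⟩ : ∃ t', t = t' + 1 := ⟨t - 1, by omega⟩
  have hx := neg_lt_of_mem_cell hi
  have hst' : (s : ℝ) ≤ t := by exact_mod_cast Nat.lt_succ_iff.1 hst
  obtain ⟨i', hi'⟩ := exists_mem_cell (s := t) (x := x) (by linarith)
  obtain ⟨h1, h2⟩ := mem_cell_parent hi' hj
  refine h.2 ⟨h1, ?_⟩
  rw [h2]
  exact hc.descendant (Nat.lt_succ_iff.1 hst) hi hi'

/-- Distinct accepted cells are disjoint. -/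
theorem Accepted.unique {s t i j : ℕ} {x : ℝ} (h : Accepted l r s i) (h' : Accepted l r t j)
    (hi : x ∈ cell s i) (hj : x ∈ cell t j) : s = t ∧ i = j := by
  rcases lt_trichotomy s t with hst | rfl | hst
  · exact absurd h.1 (h'.not_covered hj hst hi)
  · exact ⟨rfl, cell_index_unique hi hj⟩
  · exact absurd h'.1 (h.not_covered hi hst hj)

/-- The accepted cells cover the open set. -/
theorem exists_accepted {x : ℝ} {k : ℕ} (hx : x ∈ Set.Ioo (l k) (r k)) :
    ∃ s j, Accepted l r s j ∧ x ∈ cell s j := by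
  classical
  have hex : ∃ s j, Covered l r s j ∧ x ∈ cell s j := by
    have hε : 0 < min (x - l k) (r k - x) := lt_min (by linarith [hx.1]) (by linarith [hx.2])
    obtain ⟨n, hn⟩ := exists_pow_lt_of_lt_one hε (show (1 / 2 : ℝ) < 1 by norm_num)
    obtain ⟨m, hm⟩ := exists_nat_gt (-x)
    set s := max n (max m (k + 1))
    have hms : (m : ℝ) ≤ s := by exact_mod_cast (le_max_left m (k + 1)).trans (le_max_right _ _)
    obtain ⟨j, hj⟩ := exists_mem_cell (s := s) (x := x) (by linarith)
    refine ⟨s, j, ⟨k, ?_, ?_⟩, hj⟩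
    · exact Nat.lt_of_succ_le ((le_max_right m (k + 1)).trans (le_max_right n _))
    · have h1 : (1 / 2 : ℝ) ^ s ≤ (1 / 2) ^ n :=
        pow_le_pow_of_le_one (by norm_num) (by norm_num) (le_max_left _ _)
      rw [one_div_pow] at h1
      have h2 := hn.trans_le (min_le_left _ _)
      have h3 := hn.trans_le (min_le_right _ _)
      obtain ⟨h4, h5⟩ := hj
      constructor <;> linarith
  obtain ⟨j, hj, hxj⟩ := Nat.find_spec hex
  -- At the least covered level the parent cannot be covered. This level is positive, since at level
  -- `0` no interval is available.
  refine ⟨Nat.find hex, j, ⟨hj, fun ⟨h1, h2⟩ => ?_⟩, hxj⟩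
  obtain ⟨k, hk, -⟩ := hj
  have hmin := Nat.find_min hex (m := Nat.find hex - 1) (by omega)
  refine hmin ⟨_, h2, ?_⟩
  generalize hs : Nat.find hex = s at *
  obtain ⟨t, rfl⟩ : ∃ t, s = t + 1 := ⟨s - 1, by omega⟩
  obtain ⟨h3, h4⟩ := cell_subset_parent (s := t) (i := (j - 2 ^ (t + 1)) / 2) (j := j)
    (by omega) (by omega)
  exact ⟨h3.trans_lt hxj.1, hxj.2.trans h4⟩

/-- The contribution of the cell coded by `e` to the decomposition. -/
def acceptedCell (l r : ℕ → ℝ) (e : ℕ) : Set ℝ :=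
  {x | Accepted l r e.unpair.1 e.unpair.2 ∧ x ∈ cell e.unpair.1 e.unpair.2}

open Classical in
/-- The length of the cell coded by `e` if it is accepted. -/
noncomputable def acceptedLength (l r : ℕ → ℝ) (e : ℕ) : ℝ :=
  if Accepted l r e.unpair.1 e.unpair.2 then 1 / 2 ^ e.unpair.1 else 0

theorem acceptedLength_nonneg (l r : ℕ → ℝ) (e : ℕ) : 0 ≤ acceptedLength l r e := by
  unfold acceptedLength; split_ifs <;> positivity

theorem measurableSet_acceptedCell (e : ℕ) : MeasurableSet (acceptedCell l r e) :=
  (MeasurableSet.const _).inter measurableSet_Ioc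

theorem volume_acceptedCell (e : ℕ) :
    volume (acceptedCell l r e) = ENNReal.ofReal (acceptedLength l r e) := by
  by_cases h : Accepted l r e.unpair.1 e.unpair.2
  · have : acceptedCell l r e = cell e.unpair.1 e.unpair.2 := by
      ext x; simp [acceptedCell, h]
    rw [this, cell, Real.volume_Ioc, acceptedLength, if_pos h, add_sub_cancel_left]
  · simp [acceptedCell, acceptedLength, h]

theorem volume_iUnion_Ioc_eq (l r : ℕ → ℝ) :
    volume (⋃ k, Set.Ioc (l k) (r k)) = volume (⋃ k, Set.Ioo (l k) (r k)) :=
  measure_congr (Filter.EventuallyEq.countable_iUnion fun _ => Ioo_ae_eq_Ioc.symm)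

/-- The lengths of the accepted cells sum up to the measure of the open set. -/
theorem tsum_acceptedLength (l r : ℕ → ℝ) :
    ∑' e, ENNReal.ofReal (acceptedLength l r e) = volume (⋃ k, Set.Ioo (l k) (r k)) := by
  have hdisj : Pairwise (Function.onFun Disjoint (acceptedCell l r)) := by
    intro e e' hne
    refine Set.disjoint_left.2 fun x hx hx' => hne ?_
    obtain ⟨h1, h2⟩ := hx.1.unique hx'.1 hx.2 hx'.2
    rw [← Nat.pair_unpair e, ← Nat.pair_unpair e', h1, h2]
  simp_rw [← volume_acceptedCell]
  rw [← measure_iUnion hdisj measurableSet_acceptedCell]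
  apply le_antisymm
  -- A covered cell may contain the right endpoint of its interval, so it lies only in the half-open
  -- version.
  · rw [← volume_iUnion_Ioc_eq]
    refine measure_mono (Set.iUnion_subset fun e x hx => ?_)
    obtain ⟨⟨⟨k, -, h1, h2⟩, -⟩, h3, h4⟩ := hx
    exact Set.mem_iUnion.2 ⟨k, h1.trans_lt h3, h4.trans h2⟩
  · refine measure_mono (Set.iUnion_subset fun k x hx => ?_)
    obtain ⟨s, j, h, hj⟩ := exists_accepted hx
    exact Set.mem_iUnion.2 ⟨Nat.pair s j, by simpa [acceptedCell] using ⟨h, hj⟩⟩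

end Decomposition

theorem computablePred_covered {α : Type*} [Primcodable α] {l r : ℕ → ℕ → ℕ}
    (hl : Computable₂ l) (hr : Computable₂ r) {n s j : α → ℕ} (hn : Computable n)
    (hs : Computable s) (hj : Computable j) :
    ComputablePred fun a => Covered (fun k => ratOfCode (l (n a) k))
      (fun k => ratOfCode (r (n a) k)) (s a) (j a) := by
  have hs' : Computable fun x : α × ℕ => s x.1 := hs.comp Computable.fst
  have hj' : Computable fun x : α × ℕ => j x.1 := hj.comp Computable.fst
  have hn' : Computable fun x : α × ℕ => n x.1 := hn.comp Computable.fst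
  have hoff : Computable fun x : α × ℕ => s x.1 * 2 ^ s x.1 :=
    computable_mul hs' (computable_two_pow hs')
  refine (computablePred_exists_lt hs (p := fun a k =>
    (ratOfCode (l (n a) k) : ℝ) ≤ ratOfCode (dyadicCode (j a) (s a * 2 ^ s a) (s a)) ∧
    (ratOfCode (dyadicCode (j a + 1) (s a * 2 ^ s a) (s a)) : ℝ) ≤ ratOfCode (r (n a) k)) ?_).of_eq
      fun a => ?_
  · exact computablePred_and
      (computablePred_ratOfCode_le (hl.comp hn' Computable.snd)
        (computable_dyadicCode hj' hoff hs'))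
      (computablePred_ratOfCode_le (computable_dyadicCode
        (computable_add hj' (Computable.const 1)) hoff hs') (hr.comp hn' Computable.snd))
  · have h1 : cellLeft (s a) (j a) = ratOfCode (dyadicCode (j a) (s a * 2 ^ s a) (s a)) := by
      rw [ratOfCode_dyadicCode, cellLeft]; push_cast; field_simp
    have h2 : cellLeft (s a) (j a) + 1 / 2 ^ s a =
        ratOfCode (dyadicCode (j a + 1) (s a * 2 ^ s a) (s a)) := by
      rw [ratOfCode_dyadicCode, cellLeft]; push_cast; field_simp; ring
    simp only [Covered, h2]
    rw [h1]

theorem computablePred_accepted {α : Type*} [Primcodable α] {l r : ℕ → ℕ → ℕ}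
    (hl : Computable₂ l) (hr : Computable₂ r) {n s j : α → ℕ} (hn : Computable n)
    (hs : Computable s) (hj : Computable j) :
    ComputablePred fun a => Accepted (fun k => ratOfCode (l (n a) k))
      (fun k => ratOfCode (r (n a) k)) (s a) (j a) :=
  computablePred_and (computablePred_covered hl hr hn hs hj)
    (computablePred_and (computablePred_le (computable_two_pow hs) hj)
      (computablePred_covered hl hr hn (computable_sub hs (Computable.const 1))
        (computable_div (computable_sub hj (computable_two_pow hs)) (Computable.const 2)))).not

/-! ### Images of cells -/

/-- A code of `v / 2 ^ s - B - C / 2 ^ s`. -/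
def imageLeft (B C s v : ℕ) : ℕ := dyadicCode v (C + B * 2 ^ s) s

/-- A code of `v / 2 ^ s - B + C / 2 ^ s`. -/
def imageRight (B C s v : ℕ) : ℕ := dyadicCode (v + C) (B * 2 ^ s) s

theorem ratOfCode_imageLeft (B C s v : ℕ) :
    (ratOfCode (imageLeft B C s v) : ℝ) = v / 2 ^ s - B - C / 2 ^ s := by
  rw [imageLeft, ratOfCode_dyadicCode]; push_cast; field_simp; ring

theorem ratOfCode_imageRight (B C s v : ℕ) :
    (ratOfCode (imageRight B C s v) : ℝ) = v / 2 ^ s - B + C / 2 ^ s := by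
  rw [imageRight, ratOfCode_dyadicCode]; push_cast; field_simp; ring

theorem computable_imageLeft {α : Type*} [Primcodable α] {s v : α → ℕ} (B C : ℕ)
    (hs : Computable s) (hv : Computable v) : Computable fun a => imageLeft B C (s a) (v a) :=
  computable_dyadicCode hv (computable_add (Computable.const C)
    (computable_mul (Computable.const B) (computable_two_pow hs))) hs

theorem computable_imageRight {α : Type*} [Primcodable α] {s v : α → ℕ} (B C : ℕ)
    (hs : Computable s) (hv : Computable v) : Computable fun a => imageRight B C (s a) (v a) :=
  computable_dyadicCode (computable_add hv (Computable.const C))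
    (computable_mul (Computable.const B) (computable_two_pow hs)) hs

/-- The open interval with the centre `v / 2 ^ s - B` and the radius `C / 2 ^ s`. -/
def imageInterval (B C s v : ℕ) : Set ℝ :=
  Set.Ioo (ratOfCode (imageLeft B C s v) : ℝ) (ratOfCode (imageRight B C s v))

theorem mem_imageInterval {B C s v : ℕ} {y : ℝ} :
    y ∈ imageInterval B C s v ↔ |(v : ℝ) / 2 ^ s - B - y| < C / 2 ^ s := by
  rw [imageInterval, ratOfCode_imageLeft, ratOfCode_imageRight, Set.mem_Ioo, abs_lt]
  constructor <;> rintro ⟨h1, h2⟩ <;> constructor <;> linarith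

theorem volume_imageInterval (B C s v : ℕ) :
    volume (imageInterval B C s v) = ENNReal.ofReal ((2 * C : ℕ) * (1 / 2 ^ s)) := by
  rw [imageInterval, ratOfCode_imageLeft, ratOfCode_imageRight, Real.volume_Ioo]
  congr 1; push_cast; ring

theorem ratOfCode_zero : ratOfCode 0 = 0 := by simp [ratOfCode]

/-- The numerator of the left endpoint of a cell, cut off at `0`. -/
def cellPoint (s j : ℕ) : ℕ := j - s * 2 ^ s

theorem cellPoint_div (s j : ℕ) : (cellPoint s j : ℝ) / 2 ^ s = max (cellLeft s j) 0 := by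
  have hp : (0 : ℝ) < 2 ^ s := by positivity
  have he : cellLeft s j = ((j : ℝ) - s * 2 ^ s) / 2 ^ s := by unfold cellLeft; field_simp
  rw [cellPoint, he]
  rcases le_total (s * 2 ^ s) j with h | h
  · have h' : (s : ℝ) * 2 ^ s ≤ j := by exact_mod_cast h
    rw [max_eq_left (div_nonneg (by linarith) hp.le), Nat.cast_sub h]
    push_cast; rfl
  · have h' : (j : ℝ) ≤ s * 2 ^ s := by exact_mod_cast h
    rw [max_eq_right (div_nonpos_of_nonpos_of_nonneg (by linarith) hp.le),
      Nat.sub_eq_zero_of_le h]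
    simp

theorem computable_cellPoint {α : Type*} [Primcodable α] {s j : α → ℕ} (hs : Computable s)
    (hj : Computable j) : Computable fun a => cellPoint (s a) (j a) :=
  computable_sub hj (computable_mul hs (computable_two_pow hs))

/-- In the radius, `K` pays for the Lipschitz displacement across one cell, `2` for the
approximation error, and `1` makes the inequality strict. Cutting the left endpoint off at `0` does
not move it past `x`. -/
theorem mem_imageInterval_of_approx {B K s j v : ℕ} {x y z : ℝ} (hx : x ∈ cell s j)
    (hx0 : 0 ≤ x) (hv : |(v : ℝ) / 2 ^ s - B - z| ≤ 2 / 2 ^ s)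
    (hz : |z - y| ≤ K * |(cellPoint s j : ℝ) / 2 ^ s - x|) :
    y ∈ imageInterval B (K + 3) s v := by
  have hp : (0 : ℝ) < 1 / 2 ^ s := by positivity
  have hd : |(cellPoint s j : ℝ) / 2 ^ s - x| ≤ 1 / 2 ^ s := by
    rw [cellPoint_div, abs_sub_comm, abs_of_nonneg (sub_nonneg.2 (max_le hx.1.le hx0))]
    have := le_max_left (cellLeft s j) 0
    linarith [hx.2]
  rw [mem_imageInterval]
  have h1 : |(v : ℝ) / 2 ^ s - B - y| ≤ |(v : ℝ) / 2 ^ s - B - z| + |z - y| :=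
    abs_sub_le _ _ _
  have h2 : (K : ℝ) * |(cellPoint s j : ℝ) / 2 ^ s - x| ≤ K * (1 / 2 ^ s) := by gcongr
  have h3 : ((K + 3 : ℕ) : ℝ) / 2 ^ s = K * (1 / 2 ^ s) + 2 / 2 ^ s + 1 / 2 ^ s := by
    push_cast; ring
  linarith

/-- The images may overlap, but the cells do not: subadditivity on the left meets the exact sum of
lengths on the right. -/
theorem volume_iUnion_le_mul {l r : ℕ → ℝ} {W : ℕ → Set ℝ} {C : ℕ}
    (hW : ∀ e, volume (W e) ≤ ENNReal.ofReal (C * acceptedLength l r e)) :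
    volume (⋃ e, W e) ≤ C * volume (⋃ k, Set.Ioo (l k) (r k)) := by
  rw [← tsum_acceptedLength, ← ENNReal.tsum_mul_left]
  refine (measure_iUnion_le W).trans (ENNReal.tsum_le_tsum fun e => (hW e).trans_eq ?_)
  rw [ENNReal.ofReal_mul (Nat.cast_nonneg _), ENNReal.ofReal_natCast]

theorem natCast_mul_le_inv_two_pow {a : ℝ≥0∞} {C n : ℕ} (ha : a ≤ 2⁻¹ ^ (n + C)) :
    C * a ≤ (2⁻¹ : ℝ≥0∞) ^ n := by
  have hC : (C : ℝ≥0∞) ≤ 2 ^ C := by exact_mod_cast Nat.lt_two_pow_self.le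
  calc (C : ℝ≥0∞) * a ≤ 2 ^ C * 2⁻¹ ^ (n + C) := mul_le_mul' hC ha
    _ = 2⁻¹ ^ n * (2 * 2⁻¹) ^ C := by rw [pow_add, mul_pow]; ring
    _ = 2⁻¹ ^ n := by rw [ENNReal.mul_inv_cancel (by norm_num) (by norm_num)]; simp

theorem exists_nat_lipschitz_bound {f : ℝ → ℝ} {K : ℝ≥0} {X : Set ℝ}
    (hf : LipschitzOnWith K f X) (hX : Bornology.IsBounded X) :
    ∃ K' B : ℕ, (∀ x ∈ X, ∀ y ∈ X, |f x - f y| ≤ K' * |x - y|) ∧ ∀ x ∈ X, |f x| + 1 ≤ B := by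
  obtain ⟨K', hK'⟩ := exists_nat_ge (K : ℝ)
  have hL : ∀ x ∈ X, ∀ y ∈ X, |f x - f y| ≤ K' * |x - y| := fun x hx y hy => by
    have h := hf.dist_le_mul x hx y hy
    rw [Real.dist_eq, Real.dist_eq] at h
    exact h.trans (by gcongr)
  rcases X.eq_empty_or_nonempty with rfl | ⟨x₀, hx₀⟩
  · exact ⟨K', 0, hL, by simp⟩
  obtain ⟨D, hD⟩ := Metric.isBounded_iff.1 hX
  obtain ⟨B, hB⟩ := exists_nat_ge (|f x₀| + K' * D + 1)
  refine ⟨K', B, hL, fun x hx => ?_⟩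
  have h1 := hL x hx x₀ hx₀
  have h2 : (K' : ℝ) * |x - x₀| ≤ K' * D := by gcongr; exact hD hx hx₀
  have h3 := abs_sub_abs_le_abs_sub (f x) (f x₀)
  linarith

/-! ### Martin-Löf randomness -/

theorem not_martinLofRandom_of_clOpenReducible {α β : ℝ} (hβ : 0 < β)
    (h : ClOpenReducible α β) (hr : ¬ MartinLofRandom β) : ¬ MartinLofRandom α := by
  classical
  obtain ⟨f, ⟨hfc, hfl⟩, K₀, hK₀⟩ := h
  obtain ⟨K, B, hK, hB⟩ := exists_nat_lipschitz_bound hK₀ (Metric.isBounded_Ico 0 β)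
  obtain ⟨G, hG, hGf⟩ := hfc.exists_dyadic_approx B fun x hx => by
    have := hB x hx; have := neg_abs_le (f x); linarith
  -- The Lipschitz bound passes to the limit, with `α` in the role of `f β`.
  have hlim : ∀ x ∈ Set.Ico 0 β, |f x - α| ≤ K * |x - β| := fun x hx => by
    have hmem : ∀ᶠ y in 𝓝[<] β, y ∈ Set.Ico 0 β := Ico_mem_nhdsLT hβ
    refine le_of_tendsto_of_tendsto (b := 𝓝[<] β) (f := fun y => |f x - f y|)
      (g := fun y => K * |x - y|) ((tendsto_const_nhds.sub hfl).abs) ?_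
      (hmem.mono fun y hy => hK x hx y hy)
    exact (((continuous_const.sub continuous_id).abs.const_mul _).tendsto β).mono_left
      nhdsWithin_le_nhds
  simp only [MartinLofRandom, not_forall, not_not] at hr
  obtain ⟨U, ⟨⟨l, r, hl, hr, hU⟩, hμ⟩, hβU⟩ := hr
  obtain ⟨stage, hst, hstG⟩ := exists_computable_stages
    (g := fun e => G (cellPoint e.unpair.1 e.unpair.2, e.unpair.1))
    (hG.comp ((computable_cellPoint (computable_unpair_fst Computable.id)
      (computable_unpair_snd Computable.id)).pair (computable_unpair_fst Computable.id)))
  set C := K + 3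
  let A : ℕ → ℕ → Prop := fun n e => Accepted (fun k => ratOfCode (l (n + 2 * C) k))
    (fun k => ratOfCode (r (n + 2 * C) k)) e.unpair.1 e.unpair.2
  -- The index `k` codes a cell and a number of stages, so diverging computations do not block the
  -- enumeration. When there is no value yet, `code` gives `0` for both endpoints, an empty
  -- interval.
  let val : ℕ → ℕ → Option ℕ := fun n k =>
    if A n k.unpair.1 then stage k.unpair.1 k.unpair.2 else none
  let code : (ℕ → ℕ → ℕ) → ℕ → ℕ → ℕ := fun F n k =>
    ((val n k).map fun v => F k.unpair.1.unpair.1 v).getD 0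
  have he : Computable fun x : ℕ × ℕ => x.2.unpair.1 := computable_unpair_fst Computable.snd
  have hval : Computable₂ val :=
    computable_ite (computablePred_accepted hl hr
      (computable_add Computable.fst (Computable.const (2 * C)))
      (computable_unpair_fst he) (computable_unpair_snd he))
      (hst.comp he (computable_unpair_snd Computable.snd)) (Computable.const none)
  have hcode : ∀ F : ℕ → ℕ → ℕ, Computable₂ F → Computable₂ (code F) := fun F hF =>
    Computable.option_getD (Computable.option_map hval
      (hF.comp (computable_unpair_fst (he.comp Computable.fst)) Computable.snd).to₂)
      (Computable.const 0)
  intro hα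
  refine hα (fun n => ⋃ k, Set.Ioo (ratOfCode (code (imageLeft B C) n k) : ℝ)
    (ratOfCode (code (imageRight B C) n k))) ⟨⟨_, _, hcode _ ?_, hcode _ ?_, fun n => rfl⟩, ?_⟩ ?_
  · exact computable_imageLeft B C Computable.fst Computable.snd
  · exact computable_imageRight B C Computable.fst Computable.snd
  · intro n
    refine le_trans (le_trans (measure_mono (t := ⋃ e, ⋃ v,
      {y | A n e ∧ v ∈ G (cellPoint e.unpair.1 e.unpair.2, e.unpair.1) ∧
        y ∈ imageInterval B C e.unpair.1 v}) ?_)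
      (volume_iUnion_le_mul (C := 2 * C) (l := fun k => ratOfCode (l (n + 2 * C) k))
        (r := fun k => ratOfCode (r (n + 2 * C) k)) fun e => ?_)) ?_
    · refine Set.iUnion_subset fun k y hy => ?_
      by_cases hA : A n k.unpair.1
      · rcases hv : stage k.unpair.1 k.unpair.2 with _ | v
        · simp [code, val, hA, hv] at hy
        · simp only [code, val, hA, hv, if_true, Option.map_some, Option.getD_some] at hy
          exact Set.mem_iUnion₂.2 ⟨k.unpair.1, v, hA, (hstG _ _).2 ⟨_, hv⟩, hy⟩
      · simp [code, val, hA] at hy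
    · by_cases hA : A n e
      · have hL : acceptedLength (fun k => (ratOfCode (l (n + 2 * C) k) : ℝ))
            (fun k => ratOfCode (r (n + 2 * C) k)) e = 1 / 2 ^ e.unpair.1 := if_pos hA
        rw [hL]
        -- All stages of one cell yield the same value, hence at most one interval; its length does
        -- not depend on whether the value is correct.
        rcases Part.eq_none_or_eq_some (G (cellPoint e.unpair.1 e.unpair.2, e.unpair.1)) with
          hn | ⟨v, hv⟩
        · simp [hn]
        · rw [← volume_imageInterval B C e.unpair.1 v]
          refine measure_mono (Set.iUnion_subset fun w y hy => ?_)
          obtain ⟨-, hw, hy⟩ := hy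
          rw [hv, Part.mem_some_iff] at hw
          rwa [hw] at hy
      · simp [hA]
    · refine natCast_mul_le_inv_two_pow ?_
      rw [← hU]
      exact hμ _
  · refine Set.mem_iInter.2 fun n => ?_
    have hx := Set.mem_iInter.1 hβU (n + 2 * C)
    rw [hU] at hx
    obtain ⟨k, hk⟩ := Set.mem_iUnion.1 hx
    obtain ⟨s, j, hacc, hj⟩ := exists_accepted
      (l := fun k => (ratOfCode (l (n + 2 * C) k) : ℝ))
      (r := fun k => ratOfCode (r (n + 2 * C) k)) hk
    -- Strictness at `β` uses that cells exclude their left endpoint.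
    have hpt : (cellPoint s j / 2 ^ s : ℝ) ∈ Set.Ico 0 β := by
      rw [cellPoint_div]
      exact ⟨le_max_right _ _, max_lt hj.1 hβ⟩
    obtain ⟨v, hv, hvf⟩ := hGf _ _ hpt
    obtain ⟨t, ht⟩ := (hstG (Nat.pair s j) v).1 (by simpa using hv)
    refine Set.mem_iUnion.2 ⟨Nat.pair (Nat.pair s j) t, ?_⟩
    have hy : α ∈ imageInterval B C s v :=
      mem_imageInterval_of_approx hj hβ.le hvf (hlim _ hpt)
    simpa [code, val, A, hacc, ht, imageInterval] using hy

/-! ### Schnorr randomness -/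

open Classical in
/-- The measure of a finite union of intervals with endpoints on a dyadic grid is found by
counting cells. -/
theorem volume_iUnion_lt_eq_count {l r : ℕ → ℝ} {N : ℕ}
    (hl : ∀ k < N, ∃ a : ℤ, l k * 2 ^ N = a) (hr : ∀ k < N, ∃ a : ℤ, r k * 2 ^ N = a)
    (hlN : ∀ k < N, -(N : ℝ) ≤ l k) (hrN : ∀ k < N, r k ≤ N) :
    (volume (⋃ k < N, Set.Ioo (l k) (r k))).toReal =
      ((∑ j ∈ Finset.range (2 * N * 2 ^ N), if Covered l r N j then 1 else 0 : ℕ) : ℝ) /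
        2 ^ N := by
  have hp : (0 : ℝ) < 2 ^ N := by positivity
  set F := (Finset.range (2 * N * 2 ^ N)).filter fun j => Covered l r N j
  have hset : (⋃ k < N, Set.Ioc (l k) (r k)) = ⋃ j ∈ F, cell N j := by
    ext x
    simp only [Set.mem_iUnion, exists_prop]
    constructor
    · rintro ⟨k, hk, hx1, hx2⟩
      obtain ⟨j, hj⟩ := exists_mem_cell (s := N) (x := x) ((hlN k hk).trans_lt hx1)
      obtain ⟨a, ha⟩ := hl k hk
      obtain ⟨b, hb⟩ := hr k hk
      have hj' := mem_cell_iff.1 hj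
      -- Interval endpoints are grid points, so a cell that meets an interval `Ioc` lies inside it.
      have haj : a + N * 2 ^ N ≤ (j : ℤ) := by
        rw [← Int.lt_add_one_iff, ← Int.cast_lt (R := ℝ)]
        push_cast
        rw [← ha]
        have := mul_lt_mul_of_pos_right hx1 hp
        linarith [hj'.2]
      have hbj : (j : ℤ) + 1 ≤ b + N * 2 ^ N := by
        rw [Int.add_one_le_iff, ← Int.cast_lt (R := ℝ)]
        push_cast
        rw [← hb]
        have := mul_le_mul_of_nonneg_right hx2 hp.le
        linarith [hj'.1]
      have hbN : b ≤ N * 2 ^ N := by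
        rw [← Int.cast_le (R := ℝ)]
        push_cast
        rw [← hb]
        exact mul_le_mul_of_nonneg_right (hrN k hk) hp.le
      have hjN : j < 2 * N * 2 ^ N := by
        zify; linarith
      refine ⟨j, Finset.mem_filter.2 ⟨Finset.mem_range.2 hjN, k, hk, ?_, ?_⟩, hj⟩
      · rw [← Int.cast_le (R := ℝ)] at haj
        push_cast at haj
        rw [← ha] at haj
        rw [cellLeft, le_sub_iff_add_le, le_div_iff₀ hp]
        linarith
      · rw [← Int.cast_le (R := ℝ)] at hbj
        push_cast at hbj
        rw [← hb] at hbj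
        have : ((j : ℝ) + 1) / 2 ^ N ≤ r k + N := by
          rw [div_le_iff₀ hp]; linarith
        rw [add_div] at this
        rw [cellLeft]
        linarith
    · rintro ⟨j, hj, hx1, hx2⟩
      obtain ⟨k, hk, h1, h2⟩ := (Finset.mem_filter.1 hj).2
      exact ⟨k, hk, h1.trans_lt hx1, hx2.trans h2⟩
  have hae : volume (⋃ k < N, Set.Ioo (l k) (r k)) = volume (⋃ k < N, Set.Ioc (l k) (r k)) :=
    measure_congr (Filter.EventuallyEq.countable_iUnion fun k =>
      Filter.EventuallyEq.countable_iUnion fun _ => Ioo_ae_eq_Ioc)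
  have hcell : ∀ j, volume (cell N j) = ENNReal.ofReal (1 / 2 ^ N) := fun j => by
    rw [cell, Real.volume_Ioc, add_sub_cancel_left]
  rw [hae, hset, measure_biUnion_finset (f := cell N) _ fun j _ => measurableSet_Ioc]
  · simp_rw [hcell]
    rw [← Finset.card_filter, Finset.sum_const, nsmul_eq_mul, ENNReal.toReal_mul,
      ENNReal.toReal_natCast, ENNReal.toReal_ofReal (by positivity), mul_one_div]
  · intro i _ j _ hij
    exact Set.disjoint_left.2 fun x hi hj => hij (cell_index_unique hi hj)

theorem hasSum_acceptedLength {l r : ℕ → ℝ} (h : volume (⋃ k, Set.Ioo (l k) (r k)) ≠ ⊤) :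
    HasSum (acceptedLength l r) (volume (⋃ k, Set.Ioo (l k) (r k))).toReal := by
  rw [← tsum_acceptedLength] at h ⊢
  have := ENNReal.hasSum_toReal h
  rw [ENNReal.tsum_toReal_eq fun _ => ENNReal.ofReal_ne_top]
  simpa [ENNReal.toReal_ofReal (acceptedLength_nonneg l r _)] using this

/-- The measure of a union of images of accepted cells is approximated by the measure of the
union of the first `N` of them. -/
theorem abs_volume_sub_le {l r : ℕ → ℝ} {W : ℕ → Set ℝ} {C : ℕ}
    (hfin : volume (⋃ k, Set.Ioo (l k) (r k)) ≠ ⊤)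
    (hW : ∀ e, volume (W e) ≤ ENNReal.ofReal (C * acceptedLength l r e)) (N : ℕ) :
    |(volume (⋃ e, W e)).toReal - (volume (⋃ e < N, W e)).toReal| ≤
      C * ((volume (⋃ k, Set.Ioo (l k) (r k))).toReal -
        ∑ e ∈ Finset.range N, acceptedLength l r e) := by
  have hsum := hasSum_acceptedLength hfin
  have hWfin : volume (⋃ e, W e) ≠ ⊤ := ne_top_of_le_ne_top
    (ENNReal.mul_ne_top (ENNReal.natCast_ne_top C) hfin) (volume_iUnion_le_mul hW)
  have hsub : (⋃ e < N, W e) ⊆ ⋃ e, W e :=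
    Set.iUnion_mono fun e => Set.iUnion_subset fun _ => subset_rfl
  have hNfin : volume (⋃ e < N, W e) ≠ ⊤ := ne_top_of_le_ne_top hWfin (measure_mono hsub)
  have hle : (volume (⋃ e < N, W e)).toReal ≤ (volume (⋃ e, W e)).toReal :=
    ENNReal.toReal_mono hWfin (measure_mono hsub)
  have htail : (volume (⋃ k, Set.Ioo (l k) (r k))).toReal -
      ∑ e ∈ Finset.range N, acceptedLength l r e = ∑' e, acceptedLength l r (e + N) := by
    rw [← hsum.tsum_eq, ← hsum.summable.sum_add_tsum_nat_add N]; ring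
  have hs' : Summable fun e => C * acceptedLength l r (e + N) :=
    ((summable_nat_add_iff N).2 hsum.summable).mul_left _
  have hnn : ∀ e, 0 ≤ C * acceptedLength l r (e + N) := fun e =>
    mul_nonneg (Nat.cast_nonneg _) (acceptedLength_nonneg _ _ _)
  have hcover : (⋃ e, W e) ⊆ (⋃ e < N, W e) ∪ ⋃ e, W (e + N) := by
    refine Set.iUnion_subset fun e x hx => ?_
    rcases lt_or_ge e N with h | h
    · exact Or.inl (Set.mem_iUnion₂.2 ⟨e, h, hx⟩)
    · exact Or.inr (Set.mem_iUnion.2 ⟨e - N, by rwa [Nat.sub_add_cancel h]⟩)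
  have hmain : volume (⋃ e, W e) ≤ volume (⋃ e < N, W e) +
      ENNReal.ofReal (∑' e, C * acceptedLength l r (e + N)) := by
    refine (measure_mono hcover).trans ((measure_union_le _ _).trans ?_)
    gcongr
    rw [ENNReal.ofReal_tsum_of_nonneg hnn hs']
    exact (measure_iUnion_le _).trans (ENNReal.tsum_le_tsum fun e => hW _)
  have hreal := ENNReal.toReal_mono (ENNReal.add_ne_top.2 ⟨hNfin, ENNReal.ofReal_ne_top⟩) hmain
  rw [ENNReal.toReal_add hNfin ENNReal.ofReal_ne_top, ENNReal.toReal_ofReal (tsum_nonneg hnn),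
    tsum_mul_left, ← htail] at hreal
  rw [abs_of_nonneg (sub_nonneg.2 hle)]
  linarith

/-- Given approximations of the measure of the open sets, one can compute how many cells exhaust
all but a given part of that measure. -/
theorem exists_computable_exhaustion {l r : ℕ → ℕ → ℕ} (hl : Computable₂ l) (hr : Computable₂ r)
    (hfin : ∀ n, volume (⋃ k, Set.Ioo (ratOfCode (l n k) : ℝ) (ratOfCode (r n k))) ≠ ⊤)
    (hμ : UniformlyComputable fun n =>
      (volume (⋃ k, Set.Ioo (ratOfCode (l n k) : ℝ) (ratOfCode (r n k)))).toReal) (D : ℕ) :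
    ∃ N : ℕ → ℕ → ℕ, Computable₂ N ∧ ∀ n i, D ≤ N n i ∧
      (volume (⋃ k, Set.Ioo (ratOfCode (l n k) : ℝ) (ratOfCode (r n k)))).toReal -
        ∑ e ∈ Finset.range (N n i), acceptedLength (fun k => ratOfCode (l n k))
          (fun k => ratOfCode (r n k)) e ≤ 3 / 2 ^ i := by
  classical
  obtain ⟨a, ha, haμ⟩ := hμ
  set μ : ℕ → ℝ := fun n =>
    (volume (⋃ k, Set.Ioo (ratOfCode (l n k) : ℝ) (ratOfCode (r n k)))).toReal
  let len : ℕ → ℕ → ℝ := fun n =>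
    acceptedLength (fun k => ratOfCode (l n k)) (fun k => ratOfCode (r n k))
  -- The partial sum of lengths over the common denominator `2 ^ N`; the level of cell `e < N` is at
  -- most `e`.
  let σ : ℕ → ℕ → ℕ := fun n N => ∑ e ∈ Finset.range N,
    if Accepted (fun k => (ratOfCode (l n k) : ℝ)) (fun k => ratOfCode (r n k))
      e.unpair.1 e.unpair.2 then 2 ^ (N - e.unpair.1) else 0
  have hσ : ∀ n N, (σ n N : ℝ) / 2 ^ N = ∑ e ∈ Finset.range N, len n e := fun n N => by
    simp only [σ]
    rw [Nat.cast_sum, Finset.sum_div]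
    refine Finset.sum_congr rfl fun e he => ?_
    simp only [len, acceptedLength]
    have hs : e.unpair.1 ≤ N := (Nat.unpair_left_le e).trans (Finset.mem_range.1 he).le
    split_ifs
    · push_cast
      rw [pow_sub₀ _ two_ne_zero hs]
      field_simp
    · simp
  have hσc : Computable₂ σ := by
    refine computable_sum_range Computable.snd (computable_ite (computablePred_accepted hl hr
      (Computable.fst.comp Computable.fst) (computable_unpair_fst Computable.snd)
      (computable_unpair_snd Computable.snd)) (computable_two_pow (computable_sub
        (Computable.snd.comp Computable.fst) (computable_unpair_fst Computable.snd)))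
      (Computable.const 0)).to₂
  -- The slack `2 / 2 ^ i` exceeds the error `1 / 2 ^ i` of `a`, so the search for `N` terminates;
  -- success leaves at most `3 / 2 ^ i` uncovered.
  let P : ℕ × ℕ → ℕ → Prop := fun x N => D ≤ N ∧ (ratOfCode (a x.1 x.2) : ℝ) ≤
    ratOfCode (dyadicCode (σ x.1 N * 2 ^ x.2 + 2 * 2 ^ N) 0 (N + x.2))
  have hPc : ComputablePred fun p : (ℕ × ℕ) × ℕ => P p.1 p.2 := by
    have h1 : Computable fun p : (ℕ × ℕ) × ℕ => p.1.1 := Computable.fst.comp Computable.fst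
    have h2 : Computable fun p : (ℕ × ℕ) × ℕ => p.1.2 := Computable.snd.comp Computable.fst
    exact computablePred_and (computablePred_le (Computable.const D) Computable.snd)
      (computablePred_ratOfCode_le (ha.comp h1 h2) (computable_dyadicCode
        (computable_add (computable_mul (hσc.comp h1 Computable.snd) (computable_two_pow h2))
          (computable_mul (Computable.const 2) (computable_two_pow Computable.snd)))
        (Computable.const 0) (computable_add Computable.snd h2)))
  have hcode : ∀ n i N, (ratOfCode (dyadicCode (σ n N * 2 ^ i + 2 * 2 ^ N) 0 (N + i)) : ℝ) =
      ∑ e ∈ Finset.range N, len n e + 2 / 2 ^ i := fun n i N => by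
    rw [ratOfCode_dyadicCode, ← hσ]
    push_cast
    rw [pow_add]
    field_simp
    ring
  have hPex : ∀ x, ∃ N, P x N := by
    rintro ⟨n, i⟩
    have hlt : μ n - 1 / 2 ^ i < μ n := sub_lt_self _ (by positivity)
    obtain ⟨N, hN, hDN⟩ := (((hasSum_acceptedLength (hfin n)).tendsto_sum_nat.eventually_const_lt
      hlt).and (eventually_ge_atTop D)).exists
    refine ⟨N, hDN, ?_⟩
    rw [hcode]
    have := (abs_le.1 (haμ n i)).1
    rw [inv_pow, ← one_div] at this
    have h2 : (2 : ℝ) / 2 ^ i = 1 / 2 ^ i + 1 / 2 ^ i := by ring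
    change _ < ∑ e ∈ Finset.range N, len n e at hN
    rw [h2]
    linarith
  refine ⟨fun n i => Nat.find (hPex (n, i)), Computable.find hPc hPex, fun n i => ?_⟩
  obtain ⟨h1, h2⟩ := Nat.find_spec (hPex (n, i))
  refine ⟨h1, ?_⟩
  rw [hcode] at h2
  have := (abs_le.1 (haμ n i)).2
  rw [inv_pow, ← one_div] at this
  have h3 : (3 : ℝ) / 2 ^ i = 1 / 2 ^ i + 2 / 2 ^ i := by ring
  change μ n - ∑ e ∈ Finset.range _, len n e ≤ _
  rw [h3]
  linarith

theorem exists_int_mul_two_pow {s N : ℕ} (h : s ≤ N) (a : ℤ) :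
    ∃ b : ℤ, (a : ℝ) / 2 ^ s * 2 ^ N = b := by
  refine ⟨a * 2 ^ (N - s), ?_⟩
  push_cast
  rw [pow_sub₀ _ two_ne_zero h]
  field_simp

/-- A bounded computable function on an interval has computable approximations at the left
endpoints of all cells that contain points of a smaller interval. -/
theorem ComputableRealOn.exists_computable_cell_approx {f : ℝ → ℝ} {b : ℝ} {B : ℕ}
    (hf : ComputableRealOn f (Set.Icc 0 b)) (hB : ∀ x ∈ Set.Icc 0 b, |f x| + 1 ≤ B) {β : ℝ}
    (hβ : β < b) :
    ∃ γ : ℕ → ℕ, Computable γ ∧ (∀ e, (γ e : ℝ) ≤ (2 * B + 2) * 2 ^ e.unpair.1) ∧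
      ∀ e : ℕ, (cellPoint e.unpair.1 e.unpair.2 / 2 ^ e.unpair.1 : ℝ) ≤ β →
        |(γ e : ℝ) / 2 ^ e.unpair.1 - B - f (cellPoint e.unpair.1 e.unpair.2 / 2 ^ e.unpair.1)| ≤
          2 / 2 ^ e.unpair.1 := by
  classical
  obtain ⟨G, hG, hGf⟩ := hf.exists_dyadic_approx B fun x hx => by
    have := hB x hx; have := neg_abs_le (f x); linarith
  -- Comparison with a rational is decidable, unlike comparison with `β` or `b`. Beyond `q` the
  -- value is set to `0`, which makes the function total.
  obtain ⟨q, hq1, hq2⟩ := exists_rat_btwn hβ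
  obtain ⟨c, rfl⟩ := ratOfCode_surjective q
  let inside : ℕ → Prop := fun e => (ratOfCode (dyadicCode (cellPoint e.unpair.1 e.unpair.2) 0
    e.unpair.1) : ℝ) ≤ ratOfCode c
  have hs : Computable fun e : ℕ => e.unpair.1 := computable_unpair_fst Computable.id
  have hm : Computable fun e : ℕ => cellPoint e.unpair.1 e.unpair.2 :=
    computable_cellPoint hs (computable_unpair_snd Computable.id)
  have hin : ComputablePred inside := computablePred_ratOfCode_le
    (computable_dyadicCode hm (Computable.const 0) hs) (Computable.const c)
  have hin_iff : ∀ e, inside e ↔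
      (cellPoint e.unpair.1 e.unpair.2 / 2 ^ e.unpair.1 : ℝ) ≤ ratOfCode c := fun e => by
    simp only [inside]
    rw [ratOfCode_dyadicCode, Nat.cast_zero, sub_zero]
  let g : ℕ →. ℕ := fun e => bif decide (inside e) then
    G (cellPoint e.unpair.1 e.unpair.2, e.unpair.1) else Part.some 0
  have hg : Partrec g := Partrec.cond hin.decide (hG.comp (hm.pair hs))
    (Computable.const 0).partrec
  have hex : ∀ e, ∃ v ∈ g e, (v : ℝ) ≤ (2 * B + 2) * 2 ^ e.unpair.1 ∧ (inside e →
      |(v : ℝ) / 2 ^ e.unpair.1 - B - f (cellPoint e.unpair.1 e.unpair.2 / 2 ^ e.unpair.1)| ≤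
        2 / 2 ^ e.unpair.1) := fun e => by
    by_cases h : inside e
    · have hpt : (cellPoint e.unpair.1 e.unpair.2 / 2 ^ e.unpair.1 : ℝ) ∈ Set.Icc 0 b :=
        ⟨by positivity, ((hin_iff e).1 h).trans hq2.le⟩
      obtain ⟨v, hv, hvf⟩ := hGf _ _ hpt
      refine ⟨v, by simpa [g, h] using hv, ?_, fun _ => hvf⟩
      rw [← div_le_iff₀ (by positivity)]
      have h1 := (abs_le.1 hvf).2
      have h2 := hB _ hpt
      have h3 := le_abs_self (f (cellPoint e.unpair.1 e.unpair.2 / 2 ^ e.unpair.1))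
      have h4 : (2 : ℝ) / 2 ^ e.unpair.1 ≤ 2 :=
        div_le_self (by norm_num) (one_le_pow₀ (by norm_num))
      linarith
    · exact ⟨0, by simp [g, h], by simp; positivity, fun h' => absurd h' h⟩
  choose γ hγg hγB hγf using hex
  exact ⟨γ, hg.of_eq_tot hγg, hγB, fun e he => hγf e ((hin_iff e).2 (he.trans hq1.le))⟩

theorem not_schnorrRandom_of_clLocReducible {α β : ℝ} (hβ : 0 ≤ β)
    (h : ClLocReducible α β) (hr : ¬ SchnorrRandom β) : ¬ SchnorrRandom α := by
  classical
  obtain ⟨b, hb, f, hfc, ⟨K₀, hK₀⟩, rfl⟩ := h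
  obtain ⟨K, B, hK, hB⟩ := exists_nat_lipschitz_bound hK₀ (Metric.isBounded_Icc 0 b)
  obtain ⟨γ, hγ, hγB, hγf⟩ := hfc.exists_computable_cell_approx hB hb
  simp only [SchnorrRandom, not_forall, not_not] at hr
  obtain ⟨U, ⟨⟨⟨l, r, hl, hr, hU⟩, hμ⟩, hcomp⟩, hβU⟩ := hr
  obtain rfl : U = fun n => ⋃ k, Set.Ioo (ratOfCode (l n k) : ℝ) (ratOfCode (r n k)) := funext hU
  have hfin : ∀ n, volume (⋃ k, Set.Ioo (ratOfCode (l n k) : ℝ) (ratOfCode (r n k))) ≠ ⊤ :=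
    fun n => ne_top_of_le_ne_top (by simp) (hμ n)
  set C := K + 3
  -- All image intervals lie within this distance of `0`, so the first `N` of them fit the grid on
  -- `(-N, N]`.
  obtain ⟨N, hN, hNμ⟩ := exists_computable_exhaustion hl hr hfin hcomp (3 * B + C + 2)
  let A : ℕ → ℕ → Prop := fun n e => Accepted (fun k => ratOfCode (l (n + 2 * C) k))
    (fun k => ratOfCode (r (n + 2 * C) k)) e.unpair.1 e.unpair.2
  -- Accepted cells beyond `β` also get an interval, possibly a meaningless one, but of the same
  -- controlled length.
  let L : ℕ → ℕ → ℕ := fun n e => if A n e then imageLeft B C e.unpair.1 (γ e) else 0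
  let R : ℕ → ℕ → ℕ := fun n e => if A n e then imageRight B C e.unpair.1 (γ e) else 0
  have hs : Computable fun x : ℕ × ℕ => x.2.unpair.1 := computable_unpair_fst Computable.snd
  have hA : ComputablePred fun x : ℕ × ℕ => A x.1 x.2 := computablePred_accepted hl hr
    (computable_add Computable.fst (Computable.const (2 * C))) hs
    (computable_unpair_snd Computable.snd)
  have hL : Computable₂ L := computable_ite hA
    (computable_imageLeft B C hs (hγ.comp Computable.snd)) (Computable.const 0)
  have hR : Computable₂ R := computable_ite hA
    (computable_imageRight B C hs (hγ.comp Computable.snd)) (Computable.const 0)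
  have hW : ∀ n e, volume (Set.Ioo (ratOfCode (L n e) : ℝ) (ratOfCode (R n e))) ≤
      ENNReal.ofReal ((2 * C : ℕ) * acceptedLength (fun k => ratOfCode (l (n + 2 * C) k))
        (fun k => ratOfCode (r (n + 2 * C) k)) e) := fun n e => by
    by_cases h : A n e
    · have hlen : acceptedLength (fun k => (ratOfCode (l (n + 2 * C) k) : ℝ))
          (fun k => ratOfCode (r (n + 2 * C) k)) e = 1 / 2 ^ e.unpair.1 := if_pos h
      rw [hlen, ← volume_imageInterval B C e.unpair.1 (γ e), imageInterval]
      simp [L, R, h]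
    · simp [L, R, h]
  have hgrid : ∀ n M e, e < M → (∃ a : ℤ, (ratOfCode (L n e) : ℝ) * 2 ^ M = a) ∧
      ∃ a : ℤ, (ratOfCode (R n e) : ℝ) * 2 ^ M = a := fun n M e he => by
    have hsM : e.unpair.1 ≤ M := (Nat.unpair_left_le e).trans he.le
    by_cases h : A n e
    · simp only [L, R, h, if_true, imageLeft, imageRight, ratOfCode_dyadicCode]
      exact_mod_cast And.intro
        (exists_int_mul_two_pow hsM ((γ e : ℤ) - (C + B * 2 ^ e.unpair.1 : ℕ)))
        (exists_int_mul_two_pow hsM ((γ e + C : ℕ) - (B * 2 ^ e.unpair.1 : ℕ)))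
    · simp only [L, R, h, if_false, ratOfCode_zero]
      exact ⟨⟨0, by simp⟩, 0, by simp⟩
  have hbd : ∀ n e, -((3 * B + C + 2 : ℕ) : ℝ) ≤ ratOfCode (L n e) ∧
      (ratOfCode (R n e) : ℝ) ≤ (3 * B + C + 2 : ℕ) := fun n e => by
    by_cases h : A n e
    · simp only [L, R, h, if_true, ratOfCode_imageLeft, ratOfCode_imageRight]
      have h1 : (C : ℝ) / 2 ^ e.unpair.1 ≤ C :=
        div_le_self (by positivity) (one_le_pow₀ (by norm_num))
      have h2 : (γ e : ℝ) / 2 ^ e.unpair.1 ≤ 2 * B + 2 := by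
        rw [div_le_iff₀ (by positivity)]; exact hγB e
      have h3 : 0 ≤ (γ e : ℝ) / 2 ^ e.unpair.1 := by positivity
      have h4 : (0 : ℝ) ≤ B := by positivity
      push_cast
      constructor <;> linarith
    · simp only [L, R, h, if_false, ratOfCode_zero]
      rw [Rat.cast_zero]
      exact ⟨neg_nonpos.2 (Nat.cast_nonneg _), Nat.cast_nonneg _⟩
  let count : ℕ → ℕ → ℕ := fun n M => ∑ j ∈ Finset.range (2 * M * 2 ^ M),
    if Covered (fun k => (ratOfCode (L n k) : ℝ)) (fun k => ratOfCode (R n k)) M j then 1 else 0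
  have hcount : Computable₂ count := computable_sum_range
    (computable_mul (computable_mul (Computable.const 2) Computable.snd)
      (computable_two_pow Computable.snd))
    (computable_ite (computablePred_covered hL hR (Computable.fst.comp Computable.fst)
      (Computable.snd.comp Computable.fst) Computable.snd) (Computable.const 1)
      (Computable.const 0)).to₂
  intro hα
  refine hα (fun n => ⋃ k, Set.Ioo (ratOfCode (L n k) : ℝ) (ratOfCode (R n k)))
    ⟨⟨⟨L, R, hL, hR, fun n => rfl⟩, fun n => ?_⟩,
      -- The omitted images have measure at most `2 * C * 3 / 2 ^ (i + 6 * C)`, which is below `1 /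
      -- 2 ^ i` because `6 * C ≤ 2 ^ (6 * C)`.
      fun n i => dyadicCode (count n (N (n + 2 * C) (i + 6 * C))) 0 (N (n + 2 * C) (i + 6 * C)),
      ?_, fun n i => ?_⟩ ?_
  · exact (volume_iUnion_le_mul (hW n)).trans (natCast_mul_le_inv_two_pow (hμ _))
  · have hNc : Computable fun x : ℕ × ℕ => N (x.1 + 2 * C) (x.2 + 6 * C) :=
      hN.comp (computable_add Computable.fst (Computable.const _))
        (computable_add Computable.snd (Computable.const _))
    exact computable_dyadicCode (hcount.comp Computable.fst hNc) (Computable.const 0) hNc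
  · obtain ⟨h1, h2⟩ := hNμ (n + 2 * C) (i + 6 * C)
    beta_reduce
    generalize N (n + 2 * C) (i + 6 * C) = M at *
    have h1' : ((3 * B + C + 2 : ℕ) : ℝ) ≤ M := by exact_mod_cast h1
    have h3 := volume_iUnion_lt_eq_count (N := M) (fun k hk => (hgrid n M k hk).1)
      (fun k hk => (hgrid n M k hk).2) (fun k _ => (neg_le_neg h1').trans (hbd n k).1)
      (fun k _ => (hbd n k).2.trans h1')
    have h4 := abs_volume_sub_le (hfin (n + 2 * C)) (hW n) M
    rw [h3] at h4
    rw [ratOfCode_dyadicCode, Nat.cast_zero, sub_zero]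
    refine h4.trans ((mul_le_mul_of_nonneg_left h2 (Nat.cast_nonneg _)).trans ?_)
    have h5 : ((6 * C : ℕ) : ℝ) ≤ 2 ^ (6 * C) := by exact_mod_cast Nat.lt_two_pow_self.le
    rw [inv_pow, pow_add, ← one_div, mul_div_assoc', div_le_div_iff₀ (by positivity)
      (by positivity)]
    push_cast at h5 ⊢
    have h6 : (0 : ℝ) < 2 ^ i := by positivity
    nlinarith
  · refine Set.mem_iInter.2 fun n => ?_
    obtain ⟨k, hk⟩ := Set.mem_iUnion.1 (Set.mem_iInter.1 hβU (n + 2 * C))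
    obtain ⟨s, j, hacc, hj⟩ := exists_accepted
      (l := fun k => (ratOfCode (l (n + 2 * C) k) : ℝ))
      (r := fun k => ratOfCode (r (n + 2 * C) k)) hk
    have hle : (cellPoint s j / 2 ^ s : ℝ) ≤ β := by
      rw [cellPoint_div]
      exact max_le hj.1.le hβ
    have hv := hγf (Nat.pair s j) (by simpa using hle)
    simp only [Nat.unpair_pair] at hv
    refine Set.mem_iUnion.2 ⟨Nat.pair s j, ?_⟩
    have hy : f β ∈ imageInterval B C s (γ (Nat.pair s j)) :=
      mem_imageInterval_of_approx hj hβ hv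
        (hK _ ⟨by positivity, hle.trans hb.le⟩ _ ⟨hβ, hb.le⟩)
    simpa [L, R, A, hacc, imageInterval] using hy

end SolovayVariants

theorem mainTheorem6 :
    (∀ α β : ℝ, 0 < β → SolovayVariants.ClOpenReducible α β →
      ¬ SolovayVariants.MartinLofRandom β → ¬ SolovayVariants.MartinLofRandom α) ∧
    (∀ α β : ℝ, 0 ≤ β → SolovayVariants.ClLocReducible α β →
      ¬ SolovayVariants.SchnorrRandom β → ¬ SolovayVariants.SchnorrRandom α) :=
  ⟨fun _ _ => SolovayVariants.not_martinLofRandom_of_clOpenReducible,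
    fun _ _ => SolovayVariants.not_schnorrRandom_of_clLocReducible⟩
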